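/- Let $q\ge 2$, let $m,k>0$ be real numbers, and let $D_{ij},R_{ij}\ge 0$ ($1\le i,j\le q$) be real numbers with $D_{ij}=D_{ji}$, $R_{ij}=R_{ji}$ and $D_{ii}=R_{ii}=0$. Consider the array of $q$ coupled scalar oscillators $$m\ddot x_i+kx_i+\sum_{j=1}^q D_{ij}(\dot x_i-\dot x_j)+\sum_{j=1}^q R_{ij}(x_i-x_j)=0,\qquad i=1,\dots,q,$$ with $x_i(t)\in\mathbb R$. The array is said to synchronize if, for every solution (i.e. for all initial conditions), $|x_i(t)-x_j(t)|\to 0$ as $t\to\infty$ for all $i,j$. For weights $W_{ij}$ let $\mathrm{lap}(W_{ij})$ be the $q\times q$ matrix with off-diagonal entries $-W_{ij}$ and diagonal entries $\sum_l W_{il}$, and put $L_d=\mathrm{lap}(m^{-1/2}D_{ij}m^{-1/2})$, $L_r=\mathrm{lap}(m^{-1/2}R_{ij}m^{-1/2})$. For a complex $q\times q$ matrix $X$ let $\lambda_1(X),\dots,\lambda_q(X)$ be its eigenvalues, repeated according to algebraic multiplicity and ordered so that $\mathrm{Re}\,\lambda_1(X)\le\dots\le\mathrm{Re}\,\lambda_q(X)$.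 Let $\mathrm{j}=\sqrt{-1}$. Then: 1. The array synchronizes if and only if $\mathrm{Re}\,\lambda_2(L_d+\mathrm{j}L_r)>0$. 2. If $R_{ij}=0$ for all $i,j$ (so that $L_r=0$), then $\lambda_2(L_d)$ is real, and the array synchronizes if and only if $\lambda_2(L_d)>0$. -/

import Mathlib

open Filter Topology

noncomputable section

namespace OscillatorArray

/-- The Laplacian matrix `lap (W i j)` of an array of (scalar) weights: off-diagonal entries
`-W i j`, diagonal entries `∑ l, W i l`. -/
def lap {q : ℕ} (W : Fin q → Fin q → ℝ) : Matrix (Fin q) (Fin q) ℝ :=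
  Matrix.of fun i j => if i = j then ∑ l, W i l else -W i j

/-- `x i t` is the position of the `i`-th oscillator at time `t`.  The family `x` solves
`m x_i'' + k x_i + ∑_j D_ij (x_i' - x_j') + ∑_j R_ij (x_i - x_j) = 0` for all `i`;
here `v` is the velocity and `a` the acceleration. -/
def IsSolution {q : ℕ} (m k : ℝ) (D R : Fin q → Fin q → ℝ) (x : Fin q → ℝ → ℝ) : Prop :=
  ∃ v a : Fin q → ℝ → ℝ,
    (∀ i t, HasDerivAt (x i) (v i t) t) ∧
    (∀ i t, HasDerivAt (v i) (a i t) t) ∧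
    ∀ i t, m * a i t + k * x i t + ∑ j, D i j * (v i t - v j t)
      + ∑ j, R i j * (x i t - x j t) = 0

/-- The array synchronizes: along every solution (that is, for all initial conditions) all
mutual distances tend to zero. -/
def Synchronizes {q : ℕ} (m k : ℝ) (D R : Fin q → Fin q → ℝ) : Prop :=
  ∀ x : Fin q → ℝ → ℝ, IsSolution m k D R x →
    ∀ i j, Tendsto (fun t => |x i t - x j t|) atTop (𝓝 0)

/-- The Laplacian `lap (m^{-1/2} W_ij m^{-1/2})` of mass-normalized coupling weights. -/
def normLap {q : ℕ} (m : ℝ) (W : Fin q → Fin q → ℝ) : Matrix (Fin q) (Fin q) ℝ :=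
  lap fun i j => (√m)⁻¹ * W i j * (√m)⁻¹

/-- The eigenvalues of a complex matrix, repeated according to algebraic multiplicity and listed
in the order of nondecreasing real part. -/
def eigList {N : ℕ} (X : Matrix (Fin N) (Fin N) ℂ) : List ℂ :=
  X.charpoly.roots.toList.mergeSort fun a b => decide (a.re ≤ b.re)

theorem eigList_length {N : ℕ} (X : Matrix (Fin N) (Fin N) ℂ) : (eigList X).length = N := by
  rw [eigList, List.length_mergeSort, Multiset.length_toList,
    (IsAlgClosed.splits X.charpoly).natDegree_eq_card_roots.symm,
    Matrix.charpoly_natDegree_eq_dim, Fintype.card_fin]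

theorem eigList_coe {N : ℕ} (X : Matrix (Fin N) (Fin N) ℂ) :
    (eigList X : Multiset ℂ) = X.charpoly.roots := by
  rw [eigList, Multiset.coe_eq_coe.2 (List.mergeSort_perm _ _), Multiset.coe_toList]

/-- `eig X i` is the eigenvalue of `X` at position `i`, counted from `0`, with respect to
nondecreasing real part; so `eig X 1` is the second one, `λ₂(X)`. -/
def eig {N : ℕ} (X : Matrix (Fin N) (Fin N) ℂ) (i : Fin N) : ℂ :=
  (eigList X).get (i.cast (eigList_length X).symm)

theorem eig_re_mono {N : ℕ} (X : Matrix (Fin N) (Fin N) ℂ) :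
    Monotone fun i => (eig X i).re := by
  have h : (eigList X).Pairwise fun a b => a.re ≤ b.re := by
    have h0 := List.pairwise_mergeSort (le := fun a b : ℂ => decide (a.re ≤ b.re))
      (fun a b c h1 h2 => by simp at *; linarith)
      (fun a b => by simpa using le_total a.re b.re) X.charpoly.roots.toList
    exact h0.imp (by simp)
  intro i j hij
  rcases hij.eq_or_lt with rfl | hlt
  · exact le_rfl
  · exact List.pairwise_iff_get.1 h _ _ (by simpa using hlt)

/-- A real matrix regarded as a complex one. -/
def toC {N : ℕ} (X : Matrix (Fin N) (Fin N) ℝ) : Matrix (Fin N) (Fin N) ℂ :=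
  X.map fun a => (a : ℂ)

end OscillatorArray

end

-- Put `P = L_d` and `Q = L_r`. Both are positive semidefinite and annihilate the constants, and
-- division by `m` turns the array into `x'' + P x' + (k/m) x + Q x = 0`. Synchronization and the
-- spectral condition are both equivalent to `NoCommonMode P Q`: no `w ≠ 0` with zero coordinate sum
-- has `P w = 0` and `Q w = ρ w` for a real `ρ`.
--
-- Dynamics: such a `w` is never damped and gives a solution `cos (ν t) w` with `ν² = k/m + ρ`. If
-- there is none, the quadratic pencil of the centred system is singular only in the open left
-- half-plane, so deviations from the mean decay.
--
-- Spectrum: pairing an eigenvector of `P + jQ` with itself puts the eigenvalue in the closed right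
-- half-plane, and on the imaginary axis only for a common mode, where it is `jρ`. The constants
-- always use up one eigenvalue `0`. Since `0` carries no nilpotent part, its algebraic multiplicity
-- is the dimension of the common kernel of `P` and `Q`, so a second eigenvalue on the axis amounts
-- to a common mode orthogonal to the constants.

namespace OscillatorArray

open Matrix
open scoped ComplexOrder

-- Decay of linear differential equations

/-- If `u' = c u + f` with `re c < 0` and `f → 0`, then `u → 0`. -/
theorem tendsto_zero_of_hasDerivAt_smul_add {E : Type*} [NormedAddCommGroup E] [NormedSpace ℂ E]
    {u f : ℝ → E} {c : ℂ} (hc : c.re < 0) (hu : ∀ t, HasDerivAt u (c • u t + f t) t)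
    (hf : Tendsto f atTop (𝓝 0)) : Tendsto u atTop (𝓝 0) := by
  set a : ℝ := -c.re with ha
  have hapos : 0 < a := by linarith
  have hg : ∀ t : ℝ, HasDerivAt (fun s : ℝ => Complex.exp (-c * s) • u s)
      (Complex.exp (-c * t) • f t) t := by
    intro t
    have h1 : HasDerivAt (fun s : ℝ => Complex.exp (-c * s)) (Complex.exp (-c * t) * -c) t := by
      have h2 : HasDerivAt (fun s : ℝ => -c * (s : ℂ)) (-c) t := by
        simpa using (Complex.ofRealCLM.hasDerivAt (x := t)).const_mul (-c)
      exact h2.cexp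
    refine (h1.smul (hu t)).congr_deriv ?_
    rw [smul_add, smul_smul, add_right_comm, ← add_smul]
    simp
  have hnexp : ∀ t : ℝ, ‖Complex.exp (-c * t)‖ = Real.exp (a * t) := by
    intro t
    rw [Complex.norm_exp]
    simp [ha]
  rw [Metric.tendsto_atTop]
  intro ε hε
  -- The bound `a * (ε / 2)` on `f`, weighted by `exp (a s)`, integrates to `ε / 2 * exp (a s)`.
  obtain ⟨T, hT⟩ := (Metric.tendsto_atTop.1 hf) (a * (ε / 2)) (by positivity)
  set C : ℝ := ‖Complex.exp (-c * T) • u T‖ with hC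
  have hbound : ∀ t, T ≤ t → ‖u t‖ ≤ C * Real.exp (-(a * t)) + ε / 2 := by
    intro t ht
    have hB : ∀ s : ℝ, HasDerivAt
        (fun s : ℝ => C + ε / 2 * (Real.exp (a * s) - Real.exp (a * T)))
        (ε / 2 * (Real.exp (a * s) * a)) s := by
      intro s
      have h2 : HasDerivAt (fun s : ℝ => a * s) a s := by
        simpa using (hasDerivAt_id s).const_mul a
      exact ((h2.exp.sub_const _).const_mul _).const_add _
    have key := image_norm_le_of_norm_deriv_right_le_deriv_boundary
      (f := fun s : ℝ => Complex.exp (-c * s) • u s) (a := T) (b := t)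
      (fun s _ => (hg s).continuousAt.continuousWithinAt)
      (fun s _ => (hg s).hasDerivWithinAt) (B := fun s : ℝ =>
        C + ε / 2 * (Real.exp (a * s) - Real.exp (a * T)))
      (by simp [hC]) hB
      (fun s hs => by
        have := hT s hs.1
        rw [dist_zero_right] at this
        rw [norm_smul, hnexp]
        have he := Real.exp_pos (a * s)
        nlinarith)
      (Set.right_mem_Icc.2 ht)
    rw [norm_smul, hnexp] at key
    have he := Real.exp_pos (a * t)
    have heT := Real.exp_pos (a * T)
    rw [Real.exp_neg]
    have h3 : Real.exp (a * t) * ‖u t‖ ≤ C + ε / 2 * Real.exp (a * t) := by nlinarith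
    calc ‖u t‖ = Real.exp (a * t) * ‖u t‖ * (Real.exp (a * t))⁻¹ := by field_simp
      _ ≤ (C + ε / 2 * Real.exp (a * t)) * (Real.exp (a * t))⁻¹ := by gcongr
      _ = _ := by field_simp
  have hlim : Tendsto (fun t : ℝ => C * Real.exp (-(a * t))) atTop (𝓝 0) := by
    simpa using (Real.tendsto_exp_neg_atTop_nhds_zero.comp
      (tendsto_id.const_mul_atTop hapos)).const_mul C
  obtain ⟨T', hT'⟩ := eventually_atTop.1 (hlim.eventually_lt_const (half_pos hε))
  refine ⟨max T T', fun t ht => ?_⟩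
  rw [dist_zero_right]
  have h1 := hbound t (le_of_max_le_left ht)
  have h2 := hT' t (le_of_max_le_right ht)
  linarith

/-- Peeling off one factor replaces the Jordan form: `f = (M - c) z` is again a trajectory,
annihilated by the remaining factors, so it decays by induction, and `z' = c z + f`. -/
theorem tendsto_zero_of_prod_eq_zero {E : Type*} [NormedAddCommGroup E] [NormedSpace ℂ E]
    [FiniteDimensional ℂ E] (M : E →ₗ[ℂ] E) (s : Multiset ℂ) (hs : ∀ c ∈ s, c.re < 0) :
    ∀ z : ℝ → E, (∀ t, HasDerivAt z (M (z t)) t) →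
      (∀ t, Polynomial.aeval M (s.map fun c => Polynomial.X - Polynomial.C c).prod (z t) = 0) →
      Tendsto z atTop (𝓝 0) := by
  induction s using Multiset.induction_on with
  | empty =>
    intro z _ h0
    have : z = fun _ => 0 := by
      funext t
      simpa using h0 t
    rw [this]
    exact tendsto_const_nhds
  | cons c s ih =>
    intro z hz h0
    have hN : ∀ t, HasDerivAt (fun t => (M - algebraMap ℂ _ c) (z t))
        ((M - algebraMap ℂ _ c) (M (z t))) t := fun t =>
      ((M - algebraMap ℂ (Module.End ℂ E) c).toContinuousLinearMap.restrictScalars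
        ℝ).hasFDerivAt.comp_hasDerivAt t (hz t)
    refine tendsto_zero_of_hasDerivAt_smul_add (hs c (Multiset.mem_cons_self c s))
      (f := fun t => (M - algebraMap ℂ _ c) (z t)) (fun t => ?_) ?_
    · convert hz t using 1
      simp [Module.algebraMap_end_apply]
    · refine ih (fun d hd => hs d (Multiset.mem_cons_of_mem hd)) _ (fun t => ?_) fun t => ?_
      · convert hN t using 1
        simp [Module.algebraMap_end_apply]
      · have := h0 t
        rw [Multiset.map_cons, Multiset.prod_cons, mul_comm, map_mul] at this
        simpa using this

/-- Solutions of `z' = M z` decay if all eigenvalues of `M` have negative real part. -/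
theorem tendsto_zero_of_hasEigenvalue_re_neg {E : Type*} [NormedAddCommGroup E] [NormedSpace ℂ E]
    [FiniteDimensional ℂ E] (M : E →ₗ[ℂ] E) (hM : ∀ c, Module.End.HasEigenvalue M c → c.re < 0)
    (z : ℝ → E) (hz : ∀ t, HasDerivAt z (M (z t)) t) : Tendsto z atTop (𝓝 0) := by
  refine tendsto_zero_of_prod_eq_zero M M.charpoly.roots (fun c hc => hM c ?_) z hz fun t => ?_
  · rw [Module.End.hasEigenvalue_iff_isRoot_charpoly]
    exact Polynomial.isRoot_of_mem_roots hc
  · rw [← (IsAlgClosed.splits M.charpoly).eq_prod_roots_of_monic M.charpoly_monic,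
      LinearMap.aeval_self_charpoly]
    rfl

-- Positive semidefinite pairs: the pencil and `P + jQ`

section PosSemidef

variable {n : Type*} [Fintype n]

theorem mulVec_eq_zero_of_re_eq_zero {P : Matrix n n ℂ} (hP : P.PosSemidef) {x : n → ℂ}
    (h : (star x ⬝ᵥ P *ᵥ x).re = 0) : P *ᵥ x = 0 :=
  (hP.dotProduct_mulVec_zero_iff x).1 <|
    Complex.ext h (Complex.nonneg_iff.1 (hP.dotProduct_mulVec_nonneg x)).2.symm

/-- The quadratic pencil `c² + c P + κ + Q` with `P, Q ≥ 0` and `κ > 0` is singular only for `c` in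
the open left half-plane, unless `P` and `Q` have a common eigenvector in the kernel of `P`. -/
theorem re_neg_of_pencil {P Q : Matrix n n ℂ} (hP : P.PosSemidef) (hQ : Q.PosSemidef) {κ : ℝ}
    (hκ : 0 < κ) (hPQ : ∀ (w : n → ℂ) (ρ : ℝ), P *ᵥ w = 0 → Q *ᵥ w = (ρ : ℂ) • w → w = 0)
    {c : ℂ} {x : n → ℂ} (hx : x ≠ 0)
    (h : (c * c) • x + c • P *ᵥ x + (κ : ℂ) • x + Q *ᵥ x = 0) : c.re < 0 := by
  have hd : (c * c) * (star x ⬝ᵥ x) + c * (star x ⬝ᵥ P *ᵥ x) + κ * (star x ⬝ᵥ x)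
      + star x ⬝ᵥ Q *ᵥ x = 0 := by
    have := congrArg (fun y => star x ⬝ᵥ y) h
    simpa [dotProduct_add, dotProduct_smul] using this
  have hn : 0 < star x ⬝ᵥ x := dotProduct_star_self_pos_iff.2 hx
  obtain ⟨hn1, hn2⟩ := Complex.pos_iff.1 hn
  obtain ⟨hp1, hp2⟩ := Complex.nonneg_iff.1 (hP.dotProduct_mulVec_nonneg x)
  obtain ⟨hq1, hq2⟩ := Complex.nonneg_iff.1 (hQ.dotProduct_mulVec_nonneg x)
  have hre := congrArg Complex.re hd
  have him := congrArg Complex.im hd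
  simp only [Complex.add_re, Complex.mul_re, Complex.add_im, Complex.mul_im, Complex.ofReal_re,
    Complex.ofReal_im, ← hn2, ← hp2, ← hq2, Complex.zero_re, Complex.zero_im] at hre him
  by_contra! hc
  set N := (star x ⬝ᵥ x).re
  have hκN : 0 < κ * N := mul_pos hκ hn1
  have him' : c.im * (2 * c.re * N + (star x ⬝ᵥ P *ᵥ x).re) = 0 := by linarith
  have hcN : 0 ≤ c.re * N := mul_nonneg hc hn1.le
  -- Either `c` is real, and the real part is a sum of nonnegative terms with `κ * N > 0`; or two
  -- nonnegative terms cancel, so `c` is imaginary and `P x = 0`.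
  rcases mul_eq_zero.1 him' with hb | hb
  · rw [hb] at hre
    have h1 := mul_nonneg hc hp1
    have h2 := mul_nonneg hc hcN
    nlinarith
  · have hp0 : (star x ⬝ᵥ P *ᵥ x).re = 0 := by linarith
    have hc0 : c.re = 0 := by
      have : c.re * N = 0 := by linarith
      exact (mul_eq_zero.1 this).resolve_right hn1.ne'
    have hPx := mulVec_eq_zero_of_re_eq_zero hP hp0
    refine hx (hPQ x (c.im ^ 2 - κ) hPx ?_)
    rw [hPx, smul_zero, add_zero] at h
    have hcc : c * c = -((c.im ^ 2 : ℝ) : ℂ) := by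
      apply Complex.ext <;> simp [hc0, sq]
    rw [eq_neg_of_add_eq_zero_right h, hcc]
    push_cast
    module

/-- The first-order form of `y'' + P y' + κ y + Q y = 0`. -/
noncomputable def companion (P Q : Matrix n n ℂ) (κ : ℝ) :
    ((n → ℂ) × (n → ℂ)) →ₗ[ℂ] (n → ℂ) × (n → ℂ) :=
  (LinearMap.snd ℂ _ _).prod
    (-((κ : ℂ) • LinearMap.fst ℂ _ _ + Q.mulVecLin ∘ₗ LinearMap.fst ℂ _ _
      + P.mulVecLin ∘ₗ LinearMap.snd ℂ _ _))

theorem companion_apply (P Q : Matrix n n ℂ) (κ : ℝ) (z : (n → ℂ) × (n → ℂ)) :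
    companion P Q κ z = (z.2, -((κ : ℂ) • z.1 + Q *ᵥ z.1 + P *ᵥ z.2)) := by
  simp [companion]

theorem tendsto_zero_of_second_order {P Q : Matrix n n ℂ} (hP : P.PosSemidef) (hQ : Q.PosSemidef)
    {κ : ℝ} (hκ : 0 < κ)
    (hPQ : ∀ (w : n → ℂ) (ρ : ℝ), P *ᵥ w = 0 → Q *ᵥ w = (ρ : ℂ) • w → w = 0)
    {y v a : ℝ → n → ℂ} (hy : ∀ t, HasDerivAt y (v t) t) (hv : ∀ t, HasDerivAt v (a t) t)
    (h : ∀ t, a t + (κ : ℂ) • y t + P *ᵥ v t + Q *ᵥ y t = 0) : Tendsto y atTop (𝓝 0) := by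
  have hz : Tendsto (fun t => (y t, v t)) atTop (𝓝 0) := by
    refine tendsto_zero_of_hasEigenvalue_re_neg (companion P Q κ) (fun c hc => ?_) _ fun t => ?_
    · obtain ⟨⟨x, u⟩, hxu⟩ := hc.exists_hasEigenvector
      have he := hxu.apply_eq_smul
      rw [companion_apply, Prod.smul_mk, Prod.mk.injEq] at he
      obtain ⟨h1, h2⟩ := he
      dsimp only at h1 h2
      subst h1
      have hx : x ≠ 0 := by
        rintro rfl
        exact hxu.2 (by simp)
      refine re_neg_of_pencil hP hQ hκ hPQ hx ?_
      rw [mulVec_smul, smul_smul] at h2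
      rw [← h2]
      module
    · rw [companion_apply]
      refine ((hy t).prodMk (hv t)).congr_deriv ?_
      rw [Prod.mk.injEq]
      refine ⟨rfl, eq_neg_of_add_eq_zero_left ?_⟩
      rw [← h t]
      abel
  exact hz.fst_nhds

theorem re_nonneg_of_add_I_smul_mulVec {P Q : Matrix n n ℂ} (hP : P.PosSemidef)
    (hQ : Q.PosSemidef) {c : ℂ} {x : n → ℂ} (hx : x ≠ 0)
    (h : (P + Complex.I • Q) *ᵥ x = c • x) :
    0 ≤ c.re ∧ (c.re ≤ 0 → P *ᵥ x = 0 ∧ Q *ᵥ x = (c.im : ℂ) • x) := by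
  have hd : star x ⬝ᵥ P *ᵥ x + Complex.I * (star x ⬝ᵥ Q *ᵥ x) = c * (star x ⬝ᵥ x) := by
    have := congrArg (fun y => star x ⬝ᵥ y) h
    simpa [add_mulVec, smul_mulVec, dotProduct_add, dotProduct_smul] using this
  have hn : 0 < star x ⬝ᵥ x := dotProduct_star_self_pos_iff.2 hx
  obtain ⟨hn1, hn2⟩ := Complex.pos_iff.1 hn
  obtain ⟨hp1, hp2⟩ := Complex.nonneg_iff.1 (hP.dotProduct_mulVec_nonneg x)
  obtain ⟨hq1, hq2⟩ := Complex.nonneg_iff.1 (hQ.dotProduct_mulVec_nonneg x)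
  have hre := congrArg Complex.re hd
  simp only [Complex.add_re, Complex.mul_re, Complex.I_re, Complex.I_im, ← hn2, ← hq2] at hre
  have hc : 0 ≤ c.re := by
    by_contra! hc
    nlinarith [mul_pos_of_neg_of_neg hc (neg_neg_of_pos hn1)]
  refine ⟨hc, fun hc' => ?_⟩
  have hc0 := le_antisymm hc' hc
  have hPx := mulVec_eq_zero_of_re_eq_zero hP (x := x) (by rw [hc0] at hre; linarith)
  refine ⟨hPx, ?_⟩
  have hc1 : c = Complex.I * c.im := by apply Complex.ext <;> simp [hc0]
  rw [add_mulVec, hPx, zero_add, smul_mulVec, hc1, mul_smul] at h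
  simpa using smul_right_injective _ Complex.I_ne_zero h

/-- The kernel of `P + jQ` with `P, Q ≥ 0` is the common kernel. -/
theorem mulVec_eq_zero_of_add_I_smul {P Q : Matrix n n ℂ} (hP : P.PosSemidef)
    (hQ : Q.PosSemidef) {x : n → ℂ} (h : (P + Complex.I • Q) *ᵥ x = 0) :
    P *ᵥ x = 0 ∧ Q *ᵥ x = 0 := by
  by_cases hx : x = 0
  · simp [hx]
  · simpa using (re_nonneg_of_add_I_smul_mulVec hP hQ hx (c := 0) (by simpa using h)).2 le_rfl

/-- `P + jQ` with `P, Q ≥ 0` has no nilpotent part at the eigenvalue `0`. -/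
theorem mulVec_eq_zero_of_mulVec_mulVec {P Q : Matrix n n ℂ} (hP : P.PosSemidef)
    (hQ : Q.PosSemidef) {x : n → ℂ}
    (h : (P + Complex.I • Q) *ᵥ (P + Complex.I • Q) *ᵥ x = 0) :
    (P + Complex.I • Q) *ᵥ x = 0 := by
  obtain ⟨h1, h2⟩ := mulVec_eq_zero_of_add_I_smul hP hQ h
  set u := (P + Complex.I • Q) *ᵥ x with hu
  -- As `S` is Hermitian, `u* S x = (S u)* x`. Applied to `P` and `Q`, this gives `u* u = 0`.
  have key : ∀ {S : Matrix n n ℂ}, S.PosSemidef → S *ᵥ u = 0 → star u ⬝ᵥ S *ᵥ x = 0 := by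
    intro S hS h0
    rw [dotProduct_mulVec, ← hS.isHermitian.eq, ← star_mulVec, h0]
    simp
  refine dotProduct_star_self_eq_zero.1 ?_
  have : star u ⬝ᵥ u = star u ⬝ᵥ (P *ᵥ x + Complex.I • Q *ᵥ x) := by
    rw [← smul_mulVec, ← add_mulVec, ← hu]
  rw [this, dotProduct_add, dotProduct_smul, key hP h1, key hQ h2]
  simp

end PosSemidef

-- Laplacians and the constant mode

section Laplacian

variable {q : ℕ} {W : Fin q → Fin q → ℝ}

theorem lap_mulVec_apply (hdiag : ∀ i, W i i = 0) (x : Fin q → ℂ) (i : Fin q) :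
    (toC (lap W) *ᵥ x) i = ∑ j, (W i j : ℂ) * (x i - x j) := by
  have h : ∀ j, toC (lap W) i j * x j
      = (if i = j then (∑ l, (W i l : ℂ)) * x j else 0) - W i j * x j := by
    intro j
    by_cases hij : i = j
    · subst hij
      simp [toC, lap, hdiag]
    · simp [toC, lap, hij]
  simp only [mulVec, dotProduct, h, Finset.sum_sub_distrib, mul_sub, Finset.sum_ite_eq,
    Finset.mem_univ, if_true, Finset.sum_mul]

/-- Symmetrizing in `i` and `j` gives `2 x* L x = ∑ W i j |x i - x j|²`. -/
theorem posSemidef_lap (hsymm : ∀ i j, W i j = W j i) (hnonneg : ∀ i j, 0 ≤ W i j)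
    (hdiag : ∀ i, W i i = 0) : (toC (lap W)).PosSemidef := by
  refine .of_dotProduct_mulVec_nonneg ?_ fun x => ?_
  · ext i j
    by_cases hij : i = j
    · subst hij
      simp [toC, lap]
    · simp [toC, lap, hij, Ne.symm hij, hsymm i j]
  · have h1 : star x ⬝ᵥ toC (lap W) *ᵥ x
        = ∑ i, ∑ j, (W i j : ℂ) * (star (x i) * (x i - x j)) := by
      simp only [dotProduct, lap_mulVec_apply hdiag, Finset.mul_sum, Pi.star_apply]
      exact Finset.sum_congr rfl fun i _ => Finset.sum_congr rfl fun j _ => by ring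
    have h2 : star x ⬝ᵥ toC (lap W) *ᵥ x
        = ∑ i, ∑ j, (W i j : ℂ) * (star (x j) * (x j - x i)) := by
      rw [h1, Finset.sum_comm]
      exact Finset.sum_congr rfl fun i _ => Finset.sum_congr rfl fun j _ => by rw [hsymm j i]
    have h3 : 2 * (star x ⬝ᵥ toC (lap W) *ᵥ x)
        = ∑ i, ∑ j, (W i j : ℂ) * (star (x i - x j) * (x i - x j)) := by
      rw [two_mul]
      nth_rewrite 1 [h1]
      rw [h2, ← Finset.sum_add_distrib]
      refine Finset.sum_congr rfl fun i _ => ?_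
      rw [← Finset.sum_add_distrib]
      refine Finset.sum_congr rfl fun j _ => ?_
      rw [star_sub]
      ring
    have h4 : 0 ≤ 2 * (star x ⬝ᵥ toC (lap W) *ᵥ x) := by
      rw [h3]
      exact Finset.sum_nonneg fun i _ => Finset.sum_nonneg fun j _ =>
        mul_nonneg (Complex.zero_le_real.2 (hnonneg i j)) (star_mul_self_nonneg _)
    have h5 := mul_nonneg (Complex.zero_le_real.2 (by norm_num : (0 : ℝ) ≤ 1 / 2)) h4
    convert h5 using 1
    push_cast
    ring

theorem lap_mulVec_const (hdiag : ∀ i, W i i = 0) (c : ℂ) :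
    toC (lap W) *ᵥ (fun _ => c) = 0 := by
  ext i
  simp [lap_mulVec_apply hdiag]

theorem sum_lap_mulVec (hsymm : ∀ i j, W i j = W j i) (hdiag : ∀ i, W i i = 0)
    (x : Fin q → ℂ) : ∑ i, (toC (lap W) *ᵥ x) i = 0 := by
  simp only [lap_mulVec_apply hdiag, mul_sub, Finset.sum_sub_distrib]
  rw [sub_eq_zero, Finset.sum_comm]
  exact Finset.sum_congr rfl fun i _ => Finset.sum_congr rfl fun j _ => by rw [hsymm j i]

theorem normLap_weight {m : ℝ} (hm : 0 < m) (W : Fin q → Fin q → ℝ) :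
    normLap m W = lap fun i j => m⁻¹ * W i j := by
  have h : (√m)⁻¹ * (√m)⁻¹ = m⁻¹ := by rw [← mul_inv, Real.mul_self_sqrt hm.le]
  unfold normLap
  congr 1
  funext i j
  rw [← h]
  ring

theorem normLap_properties {m : ℝ} (hm : 0 < m) (hsymm : ∀ i j, W i j = W j i)
    (hnonneg : ∀ i j, 0 ≤ W i j) (hdiag : ∀ i, W i i = 0) :
    (toC (normLap m W)).PosSemidef ∧ toC (normLap m W) *ᵥ (fun _ => 1) = 0 ∧
      ∀ x, ∑ i, (toC (normLap m W) *ᵥ x) i = 0 := by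
  have hs : ∀ i j, m⁻¹ * W i j = m⁻¹ * W j i := fun i j => by rw [hsymm]
  have hd : ∀ i, m⁻¹ * W i i = 0 := fun i => by rw [hdiag, mul_zero]
  rw [normLap_weight hm]
  exact ⟨posSemidef_lap hs (fun i j => mul_nonneg (inv_nonneg.2 hm.le) (hnonneg i j)) hd,
    lap_mulVec_const hd 1, sum_lap_mulVec hs hd⟩

/-- The all-ones matrix is positive semidefinite. -/
theorem posSemidef_ones : (vecMulVec 1 (star 1) : Matrix (Fin q) (Fin q) ℂ).PosSemidef :=
  posSemidef_vecMulVec_self_star _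

theorem ones_mulVec (x : Fin q → ℂ) :
    (vecMulVec 1 (star 1) : Matrix (Fin q) (Fin q) ℂ) *ᵥ x = fun _ => ∑ i, x i := by
  ext i
  simp [vecMulVec, mulVec, dotProduct]

/-- Matrices `P` and `Q` have no common eigenvector orthogonal to the all-ones vector, with
eigenvalue `0` for `P` and a real one for `Q`. -/
def NoCommonMode (P Q : Matrix (Fin q) (Fin q) ℂ) : Prop :=
  ∀ (w : Fin q → ℂ) (ρ : ℝ), ∑ i, w i = 0 → P *ᵥ w = 0 → Q *ᵥ w = (ρ : ℂ) • w → w = 0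

/-- Adding the all-ones matrix to `P` damps the mean, so the decay theorem applies on the whole
space instead of the zero-sum subspace. -/
theorem noCommonMode_add_ones {P Q : Matrix (Fin q) (Fin q) ℂ} (hP : P.PosSemidef)
    (h : NoCommonMode P Q) (w : Fin q → ℂ) (ρ : ℝ)
    (hw : (P + vecMulVec 1 (star 1)) *ᵥ w = 0) (hQ : Q *ᵥ w = (ρ : ℂ) • w) : w = 0 := by
  have h0 : star w ⬝ᵥ P *ᵥ w + star w ⬝ᵥ (vecMulVec 1 (star 1)) *ᵥ w = 0 := by
    rw [← dotProduct_add, ← add_mulVec, hw, dotProduct_zero]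
  have h1 := hP.dotProduct_mulVec_nonneg w
  have h2 := (posSemidef_ones (q := q)).dotProduct_mulVec_nonneg w
  have hPw : P *ᵥ w = 0 := (hP.dotProduct_mulVec_zero_iff w).1
    ((add_eq_zero_iff_of_nonneg h1 h2).1 h0).1
  rw [add_mulVec, hPw, zero_add, ones_mulVec] at hw
  by_cases hq : Nonempty (Fin q)
  · exact h w ρ (congrFun hw hq.some) hPw hQ
  · funext i
    exact (hq ⟨i⟩).elim

end Laplacian

-- Ordered eigenvalues and multiplicities

section Eigenvalues

variable {q : ℕ}

theorem mem_roots_iff {X : Matrix (Fin q) (Fin q) ℂ} {c : ℂ} :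
    c ∈ X.charpoly.roots ↔ ∃ x, x ≠ 0 ∧ X *ᵥ x = c • x := by
  rw [Polynomial.mem_roots X.charpoly_monic.ne_zero, ← Matrix.charpoly_toLin',
    ← Module.End.hasEigenvalue_iff_isRoot_charpoly]
  constructor
  · intro h
    obtain ⟨x, hx⟩ := h.exists_hasEigenvector
    exact ⟨x, hx.2, by simpa using hx.apply_eq_smul⟩
  · rintro ⟨x, hx, h⟩
    exact Module.End.hasEigenvalue_of_hasEigenvector
      (x := x) ⟨Module.End.mem_eigenspace_iff.2 (by simpa using h), hx⟩

theorem eig_mem_roots (X : Matrix (Fin q) (Fin q) ℂ) (i : Fin q) :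
    eig X i ∈ X.charpoly.roots := by
  rw [← eigList_coe, Multiset.mem_coe]
  exact List.get_mem _ _

theorem eig_eq_getD (X : Matrix (Fin q) (Fin q) ℂ) (i : Fin q) :
    eig X i = (eigList X).getD i 0 := by
  rw [List.getD_eq_getElem _ _ (by rw [eigList_length]; exact i.2)]
  rfl

theorem eig_pair_le_roots (X : Matrix (Fin q) (Fin q) ℂ) (hq : 2 ≤ q) :
    ({eig X ⟨0, by omega⟩, eig X ⟨1, hq⟩} : Multiset ℂ) ≤ X.charpoly.roots := by
  rw [← eigList_coe]
  have hl := eigList_length X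
  simp only [eig_eq_getD]
  generalize eigList X = l at *
  match l, hl with
  | [], h => simp at h; omega
  | [_], h => simp at h; omega
  | a :: b :: l, h =>
    exact Multiset.coe_le.2 ((List.sublist_append_left [a, b] l).subperm)

/-- Otherwise only the head of the sorted list could have nonpositive real part, leaving no room for
two such roots. -/
theorem eig_one_re_nonpos_of_pair_le_roots {X : Matrix (Fin q) (Fin q) ℂ} (hq : 2 ≤ q) {a b : ℂ}
    (ha : a.re ≤ 0) (hb : b.re ≤ 0) (hab : ({a, b} : Multiset ℂ) ≤ X.charpoly.roots) :
    (eig X ⟨1, hq⟩).re ≤ 0 := by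
  by_contra! hpos
  have hmono : ∀ i : Fin q, 1 ≤ i.1 → 0 < (eig X i).re := fun i hi =>
    hpos.trans_le (eig_re_mono X (show (⟨1, hq⟩ : Fin q) ≤ i from hi))
  rw [← eigList_coe] at hab
  have hl := eigList_length X
  simp only [eig_eq_getD] at hmono
  clear hpos
  generalize eigList X = l at *
  match l, hl with
  | [], h => simp at h; omega
  | c :: l, h =>
    have hall : ∀ d ∈ l, ¬ d.re ≤ 0 := by
      intro d hd
      obtain ⟨⟨i, hi⟩, rfl⟩ := List.get_of_mem hd
      have := hmono ⟨i + 1, by simp at h; omega⟩ (by simp)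
      simpa [List.getElem?_eq_getElem hi] using this
    have h1 := Multiset.card_le_card (Multiset.filter_le_filter (fun d : ℂ => d.re ≤ 0) hab)
    rw [← Multiset.cons_coe, Multiset.filter_cons,
      (Multiset.filter_eq_nil (s := (l : Multiset ℂ))).2 (by simpa using hall)] at h1
    have h2 : Multiset.filter (fun d : ℂ => d.re ≤ 0) {a, b} = {a, b} :=
      Multiset.filter_eq_self.2 (by simp [ha, hb])
    rw [h2] at h1
    split_ifs at h1 <;> simp at h1

/-- The hypothesis makes the chain of kernels of powers of `X` stationary from the first, so the
generalized eigenspace at `0` is the kernel. -/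
theorem count_zero_roots {X : Matrix (Fin q) (Fin q) ℂ}
    (hX : ∀ x, X *ᵥ X *ᵥ x = 0 → X *ᵥ x = 0) :
    X.charpoly.roots.count 0 = Module.finrank ℂ (LinearMap.ker X.toLin') := by
  have h0 := LinearMap.finrank_maxGenEigenspace_eq X.toLin' 0
  rw [Matrix.charpoly_toLin'] at h0
  rw [Polynomial.count_roots, ← h0]
  suffices h : Module.End.maxGenEigenspace X.toLin' 0 = LinearMap.ker X.toLin' by rw [h]
  apply le_antisymm
  · intro x hx
    obtain ⟨k, hk⟩ := (Module.End.mem_maxGenEigenspace _ _ _).1 hx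
    rw [zero_smul, sub_zero] at hk
    rw [LinearMap.mem_ker]
    induction k generalizing x with
    | zero =>
      have : x = 0 := by simpa using hk
      simp [this]
    | succ k ih =>
      rw [pow_succ, Module.End.mul_apply] at hk
      have h1 : X.toLin' x ∈ Module.End.maxGenEigenspace X.toLin' 0 :=
        (Module.End.mem_maxGenEigenspace _ _ _).2 ⟨k, by simpa using hk⟩
      have h2 := ih h1 hk
      simpa using hX x (by simpa using h2)
  · intro x hx
    exact (Module.End.mem_maxGenEigenspace _ _ _).2 ⟨1, by simpa using hx⟩

end Eigenvalues

-- The second eigenvalue and common modes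

section SecondEigenvalue

variable {q : ℕ} {P Q : Matrix (Fin q) (Fin q) ℂ}

theorem noCommonMode_of_eig_one_re_pos (hq : 2 ≤ q) (hP : P.PosSemidef) (hQ : Q.PosSemidef)
    (hP1 : P *ᵥ (fun _ => 1) = 0) (hQ1 : Q *ᵥ (fun _ => 1) = 0)
    (h : 0 < (eig (P + Complex.I • Q) ⟨1, hq⟩).re) : NoCommonMode P Q := by
  intro w ρ hsum hPw hQw
  by_contra hw
  refine h.not_ge (eig_one_re_nonpos_of_pair_le_roots hq (a := 0) (b := Complex.I * ρ)
    (by simp) (by simp) ?_)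
  have hXw : (P + Complex.I • Q) *ᵥ w = (Complex.I * ρ) • w := by
    rw [add_mulVec, hPw, smul_mulVec, hQw, zero_add, smul_smul]
  have hX1 : (P + Complex.I • Q) *ᵥ (fun _ => 1) = 0 := by
    rw [add_mulVec, hP1, smul_mulVec, hQ1, zero_add, smul_zero]
  have hone : (fun _ => 1 : Fin q → ℂ) ≠ 0 := fun h0 => by
    simpa using congrFun h0 ⟨0, by omega⟩
  -- For `ρ = 0` the eigenvalues of `1` and `w` coincide and multiplicity two is needed; otherwise
  -- they are distinct and membership suffices.
  by_cases hρ : ρ = 0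
  · subst hρ
    have hρ0 : (Complex.I * ((0 : ℝ) : ℂ)) • w = 0 := by simp
    rw [Complex.ofReal_zero, mul_zero, Multiset.insert_eq_cons, ← Multiset.replicate_one,
      ← Multiset.replicate_succ, ← Multiset.le_count_iff_replicate_le,
      count_zero_roots fun x hx => mulVec_eq_zero_of_mulVec_mulVec hP hQ hx]
    have hli : LinearIndependent ℂ ![(⟨fun _ => 1, LinearMap.mem_ker.2 hX1⟩ :
        LinearMap.ker (P + Complex.I • Q).toLin'), ⟨w, LinearMap.mem_ker.2 (by
        rw [toLin'_apply, hXw, hρ0])⟩] := by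
      rw [LinearIndependent.pair_iff]
      intro s t hst
      have hst' : s • (fun _ => 1 : Fin q → ℂ) + t • w = 0 := congrArg Subtype.val hst
      have hs : s = 0 := by
        have h1 := congrArg (fun y : Fin q → ℂ => ∑ i, y i) hst'
        simp only [Pi.add_apply, Pi.smul_apply, Finset.sum_add_distrib, ← Finset.smul_sum, hsum,
          Pi.zero_apply] at h1
        have hq0 : q ≠ 0 := by omega
        simpa [hq0] using h1
      refine ⟨hs, ?_⟩
      rw [hs, zero_smul, zero_add] at hst'
      exact (smul_eq_zero.1 hst').resolve_right hw
    simpa using hli.fintype_card_le_finrank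
  · rw [Multiset.le_iff_subset (by simpa [eq_comm] using hρ)]
    intro c hc
    rw [mem_roots_iff]
    rcases Multiset.mem_cons.1 hc with rfl | hc
    · exact ⟨_, hone, by rw [hX1, zero_smul]⟩
    · rw [Multiset.mem_singleton.1 hc]
      exact ⟨w, hw, hXw⟩

theorem eig_one_re_pos_of_noCommonMode (hq : 2 ≤ q) (hP : P.PosSemidef) (hQ : Q.PosSemidef)
    (hQs : ∀ x, ∑ i, (Q *ᵥ x) i = 0) (h : NoCommonMode P Q) :
    0 < (eig (P + Complex.I • Q) ⟨1, hq⟩).re := by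
  by_contra! hneg
  have hzero : ∀ i : Fin q, (eig (P + Complex.I • Q) i).re ≤ 0 →
      eig (P + Complex.I • Q) i = 0 := by
    intro i hi
    obtain ⟨x, hx, hXx⟩ := mem_roots_iff.1 (eig_mem_roots (P + Complex.I • Q) i)
    obtain ⟨hre, him⟩ := re_nonneg_of_add_I_smul_mulVec hP hQ hx hXx
    obtain ⟨hPx, hQx⟩ := him hi
    refine Complex.ext (le_antisymm hi hre) ?_
    -- A nonzero eigenvalue of `Q` forces zero coordinate sum on `x`, as `Q x` always sums to zero.
    by_contra hc
    refine hx (h x _ ?_ hPx hQx)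
    have := hQs x
    rw [hQx] at this
    simp only [Pi.smul_apply, ← Finset.smul_sum] at this
    exact (smul_eq_zero.1 this).resolve_left (Complex.ofReal_ne_zero.2 hc)
  have h1 := hzero _ hneg
  have h0 := hzero ⟨0, by omega⟩
    ((eig_re_mono _ (show (⟨0, by omega⟩ : Fin q) ≤ ⟨1, hq⟩ from Nat.zero_le 1)).trans hneg)
  have hle := eig_pair_le_roots (P + Complex.I • Q) hq
  rw [h0, h1, Multiset.insert_eq_cons, ← Multiset.replicate_one, ← Multiset.replicate_succ,
    ← Multiset.le_count_iff_replicate_le,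
    count_zero_roots fun x hx => mulVec_eq_zero_of_mulVec_mulVec hP hQ hx] at hle
  -- Without common modes the coordinate sum is injective on the kernel, which is thus at most a
  -- line, against multiplicity two.
  let f : LinearMap.ker (P + Complex.I • Q).toLin' →ₗ[ℂ] ℂ :=
    (∑ i, LinearMap.proj (R := ℂ) (φ := fun _ : Fin q => ℂ) i) ∘ₗ Submodule.subtype _
  have hf : Function.Injective f := by
    rw [injective_iff_map_eq_zero]
    rintro ⟨x, hx⟩ hfx
    obtain ⟨hPx, hQx⟩ := mulVec_eq_zero_of_add_I_smul hP hQ (x := x) (LinearMap.mem_ker.1 hx)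
    rw [Submodule.mk_eq_zero]
    exact h x 0 (by simpa [f] using hfx) hPx (by simpa using hQx)
  have := LinearMap.finrank_le_finrank_of_injective hf
  rw [Module.finrank_self] at this
  omega

end SecondEigenvalue

theorem eig_im_eq_zero_of_posSemidef {q : ℕ} {P : Matrix (Fin q) (Fin q) ℂ} (hP : P.PosSemidef)
    (i : Fin q) : (eig P i).im = 0 := by
  obtain ⟨x, hx, hXx⟩ := mem_roots_iff.1 (eig_mem_roots P i)
  have hd : star x ⬝ᵥ P *ᵥ x = eig P i * (star x ⬝ᵥ x) := by rw [hXx, dotProduct_smul, smul_eq_mul]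
  obtain ⟨hn1, hn2⟩ := Complex.pos_iff.1 (dotProduct_star_self_pos_iff.2 hx)
  have him := congrArg Complex.im hd
  rw [← (Complex.nonneg_iff.1 (hP.dotProduct_mulVec_nonneg x)).2, Complex.mul_im, ← hn2, mul_zero,
    zero_add] at him
  exact (mul_eq_zero.1 him.symm).resolve_right hn1.ne'

-- Synchronization and common modes

section Dynamics

variable {q : ℕ} {m k : ℝ} {D R : Fin q → Fin q → ℝ}

theorem normLap_mulVec_apply {W : Fin q → Fin q → ℝ} (hm : 0 < m) (hdiag : ∀ i, W i i = 0)
    (x : Fin q → ℂ) (i : Fin q) :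
    (toC (normLap m W) *ᵥ x) i = (m : ℂ)⁻¹ * ∑ j, (W i j : ℂ) * (x i - x j) := by
  rw [normLap_weight hm, lap_mulVec_apply (by simp [hdiag]), Finset.mul_sum]
  push_cast
  simp only [mul_assoc]

theorem synchronizes_of_noCommonMode (hm : 0 < m) (hk : 0 < k)
    (hD : (toC (normLap m D)).PosSemidef) (hR : (toC (normLap m R)).PosSemidef)
    (hDd : ∀ i, D i i = 0) (hRd : ∀ i, R i i = 0)
    (hDs : ∀ x, ∑ i, (toC (normLap m D) *ᵥ x) i = 0)
    (hRs : ∀ x, ∑ i, (toC (normLap m R) *ᵥ x) i = 0)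
    (h : NoCommonMode (toC (normLap m D)) (toC (normLap m R))) : Synchronizes m k D R := by
  rintro x ⟨v, a, hx, hv, heq⟩ i j
  have hmC : (m : ℂ) ≠ 0 := Complex.ofReal_ne_zero.2 hm.ne'
  have hqC : (q : ℂ) ≠ 0 := Nat.cast_ne_zero.2 (by rintro rfl; exact i.elim0)
  set P := toC (normLap m D) with hPdef
  set Q := toC (normLap m R) with hQdef
  -- Subtracting the mean changes neither mutual differences nor the action of `P` and `Q`.
  let cen : (Fin q → ℂ) → Fin q → ℂ := fun y i => y i - (q : ℂ)⁻¹ * ∑ l, y l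
  have hcast : ∀ {f f' : Fin q → ℝ → ℝ}, (∀ i t, HasDerivAt (f i) (f' i t) t) → ∀ t,
      HasDerivAt (fun t => cen fun i => (f i t : ℂ)) (cen fun i => (f' i t : ℂ)) t := by
    intro f f' hf t
    rw [hasDerivAt_pi]
    exact fun i => (hf i t).ofReal_comp.sub
      ((HasDerivAt.fun_sum fun l _ => (hf l t).ofReal_comp).const_mul _)
  have hcen0 : ∀ y, ∑ i, cen y i = 0 := by
    intro y
    simp [cen, Finset.sum_sub_distrib, hqC]
  have hPc : ∀ y, P *ᵥ cen y = P *ᵥ y := by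
    intro y
    ext i
    simp [hPdef, normLap_mulVec_apply hm hDd, cen]
  have hQc : ∀ y, Q *ᵥ cen y = Q *ᵥ y := by
    intro y
    ext i
    simp [hQdef, normLap_mulVec_apply hm hRd, cen]
  have hode : ∀ i t, (a i t : ℂ) + ((k / m : ℝ) : ℂ) * x i t + (P *ᵥ fun i => (v i t : ℂ)) i
      + (Q *ᵥ fun i => (x i t : ℂ)) i = 0 := by
    intro i t
    have h1 := congrArg (fun r : ℝ => (r : ℂ)) (heq i t)
    push_cast at h1
    rw [normLap_mulVec_apply hm hDd, normLap_mulVec_apply hm hRd]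
    push_cast
    field_simp
    linear_combination h1
  have hodesum : ∀ t, (∑ i, (a i t : ℂ)) + ((k / m : ℝ) : ℂ) * ∑ i, (x i t : ℂ) = 0 := by
    intro t
    have h1 := Finset.sum_congr (rfl : (Finset.univ : Finset (Fin q)) = _) fun i _ => hode i t
    simpa only [Finset.sum_add_distrib, hDs, hRs, add_zero, ← Finset.mul_sum,
      Finset.sum_const_zero] using h1
  -- The added all-ones damping vanishes on centred velocities, so the centred trajectory solves the
  -- modified equation too.
  have hlim := tendsto_zero_of_second_order (hD.add posSemidef_ones) hR (div_pos hk hm)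
    (noCommonMode_add_ones hD h) (hcast hx) (hcast hv) (fun t => by
      rw [add_mulVec, ones_mulVec, hcen0, hPc, hQc]
      ext i
      have h1 := hode i t
      have h2 := hodesum t
      simp only [cen, Pi.add_apply, Pi.smul_apply, smul_eq_mul, Pi.zero_apply, add_zero]
      linear_combination h1 - (q : ℂ)⁻¹ * h2)
  have hij := ((tendsto_pi_nhds.1 hlim i).sub (tendsto_pi_nhds.1 hlim j)).norm
  simp only [Pi.zero_apply, sub_zero, norm_zero] at hij
  refine hij.congr fun t => ?_
  rw [sub_sub_sub_cancel_right, ← Complex.ofReal_sub, Complex.norm_real, Real.norm_eq_abs]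

theorem eq_zero_of_tendsto_cos_mul {ν : ℝ} (hν : 0 < ν) {c : ℝ}
    (h : Tendsto (fun t => |Real.cos (ν * t) * c|) atTop (𝓝 0)) : c = 0 := by
  have hs : Tendsto (fun n : ℕ => (n : ℝ) * (2 * Real.pi) / ν) atTop atTop :=
    (tendsto_natCast_atTop_atTop.atTop_mul_const (by positivity)).atTop_div_const hν
  have h1 := h.comp hs
  have h2 : ((fun t => |Real.cos (ν * t) * c|) ∘ fun n : ℕ => (n : ℝ) * (2 * Real.pi) / ν)
      = fun _ => |c| := by
    funext n
    simp only [Function.comp_apply]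
    rw [mul_div_cancel₀ _ hν.ne', Real.cos_nat_mul_two_pi, one_mul]
  rw [h2] at h1
  exact abs_eq_zero.1 (tendsto_nhds_unique tendsto_const_nhds h1)

/-- A real common mode oscillates for ever, so it is constant if the array synchronizes. -/
theorem Synchronizes.eq_of_common_mode (hs : Synchronizes m k D R) {ν : ℝ} (hν : 0 < ν)
    {u : Fin q → ℝ} (hDu : ∀ i, ∑ j, D i j * (u i - u j) = 0)
    (hRu : ∀ i, ∑ j, R i j * (u i - u j) = (m * ν ^ 2 - k) * u i) (i j : Fin q) : u i = u j := by
  have hlin : ∀ t : ℝ, HasDerivAt (fun t : ℝ => ν * t) ν t := fun t => by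
    simpa using (hasDerivAt_id t).const_mul ν
  have hsol : IsSolution m k D R fun i t => Real.cos (ν * t) * u i := by
    refine ⟨fun i t => -Real.sin (ν * t) * ν * u i, fun i t => -(Real.cos (ν * t) * ν) * ν * u i,
      fun i t => ((hlin t).cos.mul_const _), fun i t => ?_, fun i t => ?_⟩
    · exact ((hlin t).sin.neg.mul_const ν).mul_const (u i) |>.congr_deriv (by ring)
    · have h1 : ∑ j, D i j * (-Real.sin (ν * t) * ν * u i - -Real.sin (ν * t) * ν * u j)
          = -Real.sin (ν * t) * ν * ∑ j, D i j * (u i - u j) := by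
        rw [Finset.mul_sum]
        exact Finset.sum_congr rfl fun j _ => by ring
      have h2 : ∑ j, R i j * (Real.cos (ν * t) * u i - Real.cos (ν * t) * u j)
          = Real.cos (ν * t) * ∑ j, R i j * (u i - u j) := by
        rw [Finset.mul_sum]
        exact Finset.sum_congr rfl fun j _ => by ring
      rw [h1, h2, hDu, hRu]
      ring
  have h := hs _ hsol i j
  simp only [← mul_sub] at h
  exact sub_eq_zero.1 (eq_zero_of_tendsto_cos_mul hν h)

theorem noCommonMode_of_synchronizes (hm : 0 < m) (hk : 0 < k)
    (hR : (toC (normLap m R)).PosSemidef)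
    (hDd : ∀ i, D i i = 0) (hRd : ∀ i, R i i = 0) (hs : Synchronizes m k D R) :
    NoCommonMode (toC (normLap m D)) (toC (normLap m R)) := by
  intro w ρ hsum hDw hRw
  by_contra hw
  have hmC : (m : ℂ) ≠ 0 := Complex.ofReal_ne_zero.2 hm.ne'
  have hρ : 0 ≤ ρ := by
    have h1 := hR.dotProduct_mulVec_nonneg w
    rw [hRw, dotProduct_smul, smul_eq_mul] at h1
    obtain ⟨hn1, hn2⟩ := Complex.pos_iff.1 (dotProduct_star_self_pos_iff.2 hw)
    have h2 := (Complex.nonneg_iff.1 h1).1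
    rw [Complex.re_ofReal_mul] at h2
    exact nonneg_of_mul_nonneg_left h2 hn1
  -- The frequency at which `cos (ν t) w` balances inertia against both restoring forces.
  set ν := √(k / m + ρ) with hνdef
  have hν : 0 < ν := Real.sqrt_pos.2 (by positivity)
  have hν2 : m * ν ^ 2 - k = m * ρ := by
    rw [hνdef, Real.sq_sqrt (by positivity)]
    field_simp
    ring
  have hD1 : ∀ i, ∑ j, (D i j : ℂ) * (w i - w j) = 0 := by
    intro i
    have := congrFun hDw i
    rw [normLap_mulVec_apply hm hDd] at this
    exact (mul_eq_zero.1 this).resolve_left (inv_ne_zero hmC)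
  have hR1 : ∀ i, ∑ j, (R i j : ℂ) * (w i - w j) = ((m * ρ : ℝ) : ℂ) * w i := by
    intro i
    have := congrFun hRw i
    rw [normLap_mulVec_apply hm hRd, inv_mul_eq_iff_eq_mul₀ hmC] at this
    rw [this]
    push_cast
    simp [mul_assoc]
  -- The array is real, so the real and imaginary parts of `w` serve as separate modes. Both are
  -- constant, and the zero sum then kills `w`.
  have hre := hs.eq_of_common_mode hν (u := fun i => (w i).re)
    (fun i => by simpa using congrArg Complex.re (hD1 i))
    (fun i => by simpa [-Complex.ofReal_mul, hν2] using congrArg Complex.re (hR1 i))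
  have him := hs.eq_of_common_mode hν (u := fun i => (w i).im)
    (fun i => by simpa using congrArg Complex.im (hD1 i))
    (fun i => by simpa [-Complex.ofReal_mul, hν2] using congrArg Complex.im (hR1 i))
  apply hw
  funext i
  have hc : ∀ j, w j = w i := fun j => Complex.ext (hre j i) (him j i)
  have hqC : (q : ℂ) ≠ 0 := Nat.cast_ne_zero.2 (by rintro rfl; exact i.elim0)
  simpa [hc, hqC] using hsum

end Dynamics

end OscillatorArray

theorem mainTheorem8 (q : ℕ) (hq : 2 ≤ q) (m k : ℝ) (hm : 0 < m) (hk : 0 < k)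
    (D R : Fin q → Fin q → ℝ)
    (hDsymm : ∀ i j, D i j = D j i) (hDnonneg : ∀ i j, 0 ≤ D i j) (hDdiag : ∀ i, D i i = 0)
    (hRsymm : ∀ i j, R i j = R j i) (hRnonneg : ∀ i j, 0 ≤ R i j) (hRdiag : ∀ i, R i i = 0) :
    (OscillatorArray.Synchronizes m k D R ↔
      0 < (OscillatorArray.eig
        (OscillatorArray.toC (OscillatorArray.normLap m D)
          + Complex.I • OscillatorArray.toC (OscillatorArray.normLap m R)) ⟨1, hq⟩).re) ∧
    ((∀ i j, R i j = 0) →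
      (OscillatorArray.eig (OscillatorArray.toC (OscillatorArray.normLap m D)) ⟨1, hq⟩).im = 0 ∧
      (OscillatorArray.Synchronizes m k D R ↔
        0 < (OscillatorArray.eig
          (OscillatorArray.toC (OscillatorArray.normLap m D)) ⟨1, hq⟩).re)) := by
  obtain ⟨hD, hD1, hDs⟩ := OscillatorArray.normLap_properties hm hDsymm hDnonneg hDdiag
  obtain ⟨hR, hR1, hRs⟩ := OscillatorArray.normLap_properties hm hRsymm hRnonneg hRdiag
  have main : OscillatorArray.Synchronizes m k D R ↔
      0 < (OscillatorArray.eig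
        (OscillatorArray.toC (OscillatorArray.normLap m D)
          + Complex.I • OscillatorArray.toC (OscillatorArray.normLap m R)) ⟨1, hq⟩).re :=
    ⟨fun h => OscillatorArray.eig_one_re_pos_of_noCommonMode hq hD hR hRs
      (OscillatorArray.noCommonMode_of_synchronizes hm hk hR hDdiag hRdiag h),
    fun h => OscillatorArray.synchronizes_of_noCommonMode hm hk hD hR hDdiag hRdiag hDs hRs
      (OscillatorArray.noCommonMode_of_eig_one_re_pos hq hD hR hD1 hR1 h)⟩
  refine ⟨main, fun hR0 => ⟨OscillatorArray.eig_im_eq_zero_of_posSemidef hD _, ?_⟩⟩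
  have hzero : OscillatorArray.toC (OscillatorArray.normLap m R) = 0 := by
    ext i j
    simp [OscillatorArray.toC, OscillatorArray.normLap, OscillatorArray.lap, hR0]
  rwa [hzero, smul_zero, add_zero] at main
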